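/- Let $n \ge 1$. A commutative unital ring is called coherent if the intersection of any two of its finitely generated ideals is finitely generated. (i) Let $\Omega \subset \mathbb{C}^n$ be a bounded domain (nonempty, open and connected), and let $A(\overline{\Omega})$ be the ring, with pointwise operations, of all continuous functions $f : \overline{\Omega} \to \mathbb{C}$ that are holomorphic on $\Omega$. Then $A(\overline{\Omega})$ is not coherent. (ii) Let $K \subset \mathbb{C}^n$ be a compact set whose interior $K^\circ$ is nonempty, and let $A(K)$ be the ring, with pointwise operations, of all continuous functions $f : K \to \mathbb{C}$ that are holomorphic on $K^\circ$. Then $A(K)$ is not coherent. -/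

import Mathlib

/-- A commutative unital ring is coherent if the intersection of any two finitely generated
ideals is finitely generated. -/
def IsCoherentRing (R : Type*) [CommRing R] : Prop :=
  ∀ I J : Ideal R, I.FG → J.FG → (I ⊓ J).FG

/-- For `U ⊆ X ⊆ ℂⁿ` with `U` open: the algebra, with pointwise operations, of the continuous
functions `X → ℂ` that are holomorphic on `U`. As `f` is defined on `X` only, this is expressed
by a function `g` on `ℂⁿ` that agrees with `f` on `U` and is complex differentiable on `U`. -/
def holomorphicSubalgebra {n : ℕ} (X U : Set (EuclideanSpace ℂ (Fin n))) :
    Subalgebra ℂ C(X, ℂ) where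
  carrier := {f | ∃ g : EuclideanSpace ℂ (Fin n) → ℂ,
    DifferentiableOn ℂ g U ∧ ∀ x : X, (x : EuclideanSpace ℂ (Fin n)) ∈ U → g x = f x}
  mul_mem' := by
    rintro f₁ f₂ ⟨g₁, hd₁, h₁⟩ ⟨g₂, hd₂, h₂⟩
    exact ⟨fun z => g₁ z * g₂ z, hd₁.mul hd₂, fun x hx => by simp [h₁ x hx, h₂ x hx]⟩
  add_mem' := by
    rintro f₁ f₂ ⟨g₁, hd₁, h₁⟩ ⟨g₂, hd₂, h₂⟩
    exact ⟨fun z => g₁ z + g₂ z, hd₁.add hd₂, fun x hx => by simp [h₁ x hx, h₂ x hx]⟩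
  algebraMap_mem' := fun c => ⟨fun _ => c, differentiableOn_const c, fun _ _ => rfl⟩

/-- `A(Ω̄)` for an open set `Ω`: the functions continuous on the closure of `Ω` and holomorphic
on `Ω` (and not necessarily on the interior of the closure). -/
abbrev domainAlgebra {n : ℕ} (Ω : Set (EuclideanSpace ℂ (Fin n))) :
    Subalgebra ℂ C(closure Ω, ℂ) :=
  holomorphicSubalgebra (closure Ω) Ω

/-- `A(K)`: the functions continuous on `K` and holomorphic on the interior of `K`. -/
abbrev compactAlgebra {n : ℕ} (K : Set (EuclideanSpace ℂ (Fin n))) : Subalgebra ℂ C(K, ℂ) :=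
  holomorphicSubalgebra K (interior K)

/-! Let `U` be `Ω` or the interior of `K`. A farthest point `x₀` of `closure U` from the origin is a
peak point: some `p` in the algebra has `Re p ≥ 0` and vanishes at `x₀` only. Put `f = p` and `g = p
^ (1 + it)` with `t` real, and let `M` be the ideal of functions vanishing at `x₀`. Then `(f) ∩ (g)
= g M`. If `a ∈ M`, then `p ^ (it) a` is in the algebra, the power being bounded, so `g a` is a
multiple of `f`. Conversely, `b f = a g` with `a x₀ ≠ 0` would make `p ^ (it) = b / a` converge at
`x₀`, which `exists_not_tendsto_cpow` excludes along a sequence for a suitable `t`.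

As `g` has no zero off `x₀`, finitely many generators `g m_s` would give `|a| ≤ C ∑ |m_s|` off `x₀`
for each `a ∈ M`. But `M` contains functions tending to `0` more slowly than any given modulus
(`exists_not_le_mul_of_peak`). -/

open Filter Topology Set Complex

/-! ### Oscillation of exponentials -/

/-- Complex numbers `c k` in a horizontal strip tending to infinity are separated by some character
`c ↦ exp (i t c)`. -/
theorem exists_not_tendsto_cexp {c : ℕ → ℂ} {B : ℝ} (hB : ∀ k, |(c k).im| ≤ B)
    (hc : Tendsto (fun k => ‖c k‖) atTop atTop) :
    ∃ t : ℝ, ¬ ∃ l, Tendsto (fun k => cexp (t * I * c k)) atTop (𝓝 l) := by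
  by_contra! hlim
  choose χ hχ using hlim
  have hnorm : ∀ (s : ℝ), |s| ≤ 1 → ∀ k, ‖cexp (s * I * c k)‖ ≤ Real.exp B := by
    intro s hs k
    rw [Complex.norm_exp, Real.exp_le_exp]
    have h1 : (s * I * c k).re = -(s * (c k).im) := by simp
    rw [h1]
    calc -(s * (c k).im) ≤ |s * (c k).im| := neg_le_abs _
      _ = |s| * |(c k).im| := abs_mul _ _
      _ ≤ 1 * B := by gcongr; exact hB k
      _ = B := one_mul B
  have habs : ∀ t ∈ uIoc (0 : ℝ) 1, |t| ≤ 1 := by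
    intro t ht
    rw [uIoc_of_le zero_le_one] at ht
    rw [abs_of_pos ht.1]; exact ht.2
  have habs' : ∀ t ∈ uIoc (0 : ℝ) 1, |(-t)| ≤ 1 := fun t ht => by rw [abs_neg]; exact habs t ht
  have hχnorm : ∀ (s : ℝ), |s| ≤ 1 → ‖χ s‖ ≤ Real.exp B := fun s hs =>
    le_of_tendsto (hχ s).norm (Eventually.of_forall (hnorm s hs))
  have hmeas : Measurable fun t : ℝ => χ (-t) := by
    refine measurable_of_tendsto_metrizable (f := fun k (t : ℝ) => cexp ((-t : ℝ) * I * c k))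
      (fun k => ?_) (tendsto_pi_nhds.2 fun t => hχ (-t))
    have : Continuous fun t : ℝ => cexp ((-t : ℝ) * I * c k) := by fun_prop
    exact this.measurable
  -- The integral of `exp (i t (c j - c k))` is explicit and is `O(1 / ‖c j - c k‖)`, so it tends to
  -- `0` as `k → ∞`; dominated convergence identifies its limit.
  have hzero : ∀ j, ∫ t in (0 : ℝ)..1, cexp (t * I * c j) * χ (-t) = 0 := by
    intro j
    have h1 : Tendsto (fun k => ∫ t in (0 : ℝ)..1, cexp (t * I * c j) * cexp ((-t : ℝ) * I * c k))
        atTop (𝓝 (∫ t in (0 : ℝ)..1, cexp (t * I * c j) * χ (-t))) := by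
      refine intervalIntegral.tendsto_integral_filter_of_dominated_convergence
        (fun _ => Real.exp B * Real.exp B) ?_ ?_ (by simp) ?_
      · refine Eventually.of_forall fun k => Continuous.aestronglyMeasurable ?_
        fun_prop
      · refine Eventually.of_forall fun k => Eventually.of_forall fun t ht => ?_
        rw [norm_mul]
        exact mul_le_mul (hnorm t (habs t ht) j) (hnorm _ (habs' t ht) k) (norm_nonneg _)
          (Real.exp_pos _).le
      · exact Eventually.of_forall fun t _ => (hχ (-t)).const_mul _
    have hd : Tendsto (fun k => ‖c j - c k‖) atTop atTop := by
      refine tendsto_atTop_mono (fun k => ?_) (tendsto_atTop_add_const_right _ (-‖c j‖) hc)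
      have := norm_sub_norm_le (c k) (c j)
      rw [norm_sub_rev] at this
      linarith
    have h2 : Tendsto (fun k => ∫ t in (0 : ℝ)..1, cexp (t * I * c j) * cexp ((-t : ℝ) * I * c k))
        atTop (𝓝 0) := by
      rw [tendsto_zero_iff_norm_tendsto_zero]
      have h3 : Tendsto (fun k => (Real.exp B * Real.exp B + 1) / ‖c j - c k‖) atTop (𝓝 0) :=
        hd.const_div_atTop _
      refine tendsto_of_tendsto_of_tendsto_of_le_of_le' tendsto_const_nhds h3
        (Eventually.of_forall fun k => norm_nonneg _) ?_
      filter_upwards [hd.eventually_gt_atTop 0] with k hk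
      have hne : I * (c j - c k) ≠ 0 := mul_ne_zero I_ne_zero (norm_pos_iff.1 hk)
      have h4 : ∀ t : ℝ, cexp (t * I * c j) * cexp ((-t : ℝ) * I * c k)
          = cexp (I * (c j - c k) * t) := by
        intro t
        rw [← Complex.exp_add]; congr 1; push_cast; ring
      simp_rw [h4]
      rw [integral_exp_mul_complex hne, norm_div, norm_mul, norm_I, one_mul]
      gcongr
      refine (norm_sub_le _ _).trans ?_
      rw [← h4 1, norm_mul]
      refine add_le_add (mul_le_mul (hnorm 1 (by simp) j) (hnorm _ (by simp) k) (norm_nonneg _)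
          (Real.exp_pos _).le) (by simp)
    exact tendsto_nhds_unique h1 h2
  have hone : ∀ t : ℝ, χ t * χ (-t) = 1 := by
    intro t
    refine tendsto_nhds_unique ((hχ t).mul (hχ (-t))) ?_
    refine tendsto_const_nhds.congr fun k => ?_
    rw [← Complex.exp_add, ← Complex.exp_zero]; congr 1; push_cast; ring
  -- Letting `j → ∞` as well turns the vanishing integrals into the integral of `1`.
  have h5 : Tendsto (fun j => ∫ t in (0 : ℝ)..1, cexp (t * I * c j) * χ (-t)) atTop
      (𝓝 (∫ t in (0 : ℝ)..1, χ t * χ (-t))) := by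
    refine intervalIntegral.tendsto_integral_filter_of_dominated_convergence
      (fun _ => Real.exp B * Real.exp B) ?_ ?_ (by simp) ?_
    · refine Eventually.of_forall fun k => MeasureTheory.AEStronglyMeasurable.mul
        (Continuous.aestronglyMeasurable ?_) hmeas.aestronglyMeasurable
      fun_prop
    · refine Eventually.of_forall fun k => Eventually.of_forall fun t ht => ?_
      rw [norm_mul]
      exact mul_le_mul (hnorm t (habs t ht) k) (hχnorm _ (habs' t ht)) (norm_nonneg _)
        (Real.exp_pos _).le
    · exact Eventually.of_forall fun t _ => (hχ t).mul_const _
  simp_rw [hzero, hone] at h5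
  have := tendsto_nhds_unique h5 tendsto_const_nhds
  simp at this

/-! ### Slow decay in the half-plane -/

theorem norm_le_norm_add_ofReal {w : ℂ} (hw : 0 ≤ w.re) {e : ℝ} (he : 0 < e) :
    ‖w‖ ≤ ‖w + e‖ := by
  rw [← sq_le_sq₀ (norm_nonneg _) (norm_nonneg _), ← normSq_eq_norm_sq, ← normSq_eq_norm_sq,
    normSq_apply, normSq_apply]
  simp only [add_re, ofReal_re, add_im, ofReal_im, add_zero]
  nlinarith [mul_nonneg hw he.le]

theorem add_ofReal_ne_zero {w : ℂ} (hw : 0 ≤ w.re) {e : ℝ} (he : 0 < e) : w + e ≠ 0 := by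
  intro h
  have := congrArg re h
  simp at this
  linarith

theorem norm_div_add_ofReal_le {w : ℂ} (hw : 0 ≤ w.re) {e : ℝ} (he : 0 < e) :
    ‖w / (w + e)‖ ≤ 1 := by
  rw [norm_div]
  exact div_le_one_of_le₀ (norm_le_norm_add_ofReal hw he) (norm_nonneg _)

theorem re_div_add_ofReal {w : ℂ} {e : ℝ} :
    (w / (w + e)).re = (‖w‖ ^ 2 + e * w.re) / ‖w + e‖ ^ 2 := by
  rw [← normSq_eq_norm_sq, ← normSq_eq_norm_sq, div_re, ← add_div, normSq_apply w]
  simp only [add_re, ofReal_re, add_im, ofReal_im, add_zero]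
  ring

/-- The Möbius map `z ↦ z / (z + r)` sends the circle `|z| = r`, minus its pole `-r`, to the line
`Re = 1/2`. -/
theorem re_div_add_norm {w : ℂ} (hw : 0 ≤ w.re) (h0 : w ≠ 0) : (w / (w + ‖w‖)).re = 1 / 2 := by
  have hp : 0 < ‖w‖ := norm_pos_iff.2 h0
  have h1 : ‖w + ‖w‖‖ ^ 2 = 2 * (‖w‖ ^ 2 + ‖w‖ * w.re) := by
    have h2 : ‖w‖ ^ 2 = w.re * w.re + w.im * w.im := by rw [← normSq_eq_norm_sq, normSq_apply]
    have h3 : ‖w + ‖w‖‖ ^ 2 = (w.re + ‖w‖) * (w.re + ‖w‖) + w.im * w.im := by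
      rw [← normSq_eq_norm_sq, normSq_apply]; simp
    rw [h3]; linarith
  have hq : ‖w‖ ^ 2 + ‖w‖ * w.re ≠ 0 := by positivity
  rw [re_div_add_ofReal, h1]
  field_simp

/-- A continuous function on the closed right half-plane, holomorphic inside, vanishing at `0` as
slowly as prescribed along a given sequence. -/
theorem exists_slowly_vanishing {w : ℕ → ℂ} (hw : ∀ k, 0 ≤ (w k).re) (h0 : ∀ k, w k ≠ 0) :
    ∃ H : ℂ → ℂ, ContinuousOn H {z | 0 ≤ z.re} ∧ DifferentiableOn ℂ H {z | 0 < z.re} ∧ H 0 = 0 ∧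
      ∀ k, (1 / 2 : ℝ) ^ k / 2 ≤ ‖H (w k)‖ := by
  have hp : ∀ k, 0 < ‖w k‖ := fun k => norm_pos_iff.2 (h0 k)
  -- All terms have nonnegative real part, so nothing cancels: at `w k` the `k`-th term alone gives
  -- the lower bound.
  set F : ℕ → ℂ → ℂ := fun k z => ((1 / 2 : ℝ) ^ k : ℝ) * (z / (z + ‖w k‖)) with hF
  have hbound : ∀ k z, 0 ≤ z.re → ‖F k z‖ ≤ (1 / 2 : ℝ) ^ k := by
    intro k z hz
    simp only [hF]
    rw [norm_mul, norm_real, Real.norm_of_nonneg (by positivity)]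
    exact mul_le_of_le_one_right (by positivity) (norm_div_add_ofReal_le hz (hp k))
  have hdiff : ∀ k z, 0 ≤ z.re → DifferentiableAt ℂ (F k) z := by
    intro k z hz
    have := add_ofReal_ne_zero hz (hp k)
    simp only [hF]
    fun_prop (disch := assumption)
  refine ⟨fun z => ∑' k, F k z, ?_, ?_, ?_, ?_⟩
  · exact continuousOn_tsum (fun k z hz => (hdiff k z hz).continuousAt.continuousWithinAt)
      summable_geometric_two hbound
  · exact Complex.differentiableOn_tsum_of_summable_norm summable_geometric_two
      (fun k z hz => (hdiff k z (le_of_lt hz)).differentiableWithinAt)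
      (isOpen_lt continuous_const continuous_re) (fun k z hz => hbound k z (le_of_lt hz))
  · simp [hF]
  · intro k
    have hs : Summable fun j => F j (w k) :=
      Summable.of_norm_bounded summable_geometric_two fun j => hbound j _ (hw k)
    have hre : ∀ j, (F j (w k)).re = (1 / 2 : ℝ) ^ j * (w k / (w k + ‖w j‖)).re := fun j =>
      re_ofReal_mul _ _
    refine le_trans ?_ (Complex.re_le_norm _)
    rw [Complex.re_tsum hs]
    have h1 : (1 / 2 : ℝ) ^ k / 2 = (F k (w k)).re := by
      rw [hre, re_div_add_norm (hw k) (h0 k)]; ring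
    rw [h1]
    refine (Complex.hasSum_re hs.hasSum).summable.le_tsum k fun j _ => ?_
    rw [hre, re_div_add_ofReal]
    have := hw k
    positivity

/-! ### Imaginary powers -/

theorem norm_cpow_mul_I_le {w : ℂ} (h0 : w ≠ 0) (t : ℝ) :
    ‖w ^ (t * I : ℂ)‖ ≤ Real.exp (|t| * Real.pi) := by
  rw [Complex.cpow_def_of_ne_zero h0, Complex.norm_exp, Real.exp_le_exp]
  have h1 : (log w * (t * I)).re = -(arg w * t) := by simp [log_im]
  rw [h1]
  calc -(arg w * t) ≤ |arg w * t| := neg_le_abs _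
    _ = |t| * |arg w| := by rw [abs_mul, mul_comm]
    _ ≤ |t| * Real.pi := by gcongr; exact abs_arg_le_pi w

/-- An imaginary power oscillates along a suitable sequence tending to `0`. -/
theorem exists_not_tendsto_cpow {w : ℕ → ℂ} (h0 : ∀ k, w k ≠ 0) (hw : Tendsto w atTop (𝓝 0)) :
    ∃ t : ℝ, ¬ ∃ l, Tendsto (fun k => w k ^ (t * I : ℂ)) atTop (𝓝 l) := by
  obtain ⟨t, ht⟩ := exists_not_tendsto_cexp (c := fun k => log (w k)) (B := Real.pi)
    (fun k => by rw [log_im]; exact abs_arg_le_pi _) (by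
      have h1 : Tendsto (fun k => ‖w k‖) atTop (𝓝[>] 0) :=
        tendsto_nhdsWithin_iff.2 ⟨by simpa using hw.norm,
          Eventually.of_forall fun k => norm_pos_iff.2 (h0 k)⟩
      refine tendsto_atTop_mono (fun k => ?_)
        (tendsto_neg_atBot_atTop.comp (Real.tendsto_log_nhdsGT_zero.comp h1))
      refine le_trans ?_ (Complex.abs_re_le_norm _)
      rw [log_re]
      exact neg_le_abs _)
  refine ⟨t, ?_⟩
  simpa only [Complex.cpow_def_of_ne_zero (h0 _), mul_comm] using ht

/-! ### The peak point -/

theorem norm_sq_sub_inner_re_nonneg {E : Type*} [NormedAddCommGroup E] [InnerProductSpace ℂ E]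
    {x y : E} (h : ‖y‖ ≤ ‖x‖) : 0 ≤ ((‖x‖ ^ 2 : ℝ) - inner ℂ x y : ℂ).re := by
  have h1 : (inner ℂ x y : ℂ).re ≤ ‖x‖ * ‖y‖ := re_inner_le_norm (𝕜 := ℂ) x y
  rw [sub_re, ofReal_re]
  nlinarith [norm_nonneg x]

/-- A farthest point of `closure U` from the origin is a peak point: some continuous function with
nonnegative real part, which is affine on `U`, vanishes at this point only. -/
theorem exists_peak {n : ℕ} (hn : 1 ≤ n) {X U : Set (EuclideanSpace ℂ (Fin n))}
    (hU : IsOpen U) (hne : U.Nonempty) (hb : Bornology.IsBounded U) (hUX : closure U ⊆ X) :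
    ∃ (x₀ : X) (p : C(X, ℂ)) (q : EuclideanSpace ℂ (Fin n) → ℂ),
      (∀ x, 0 ≤ (p x).re) ∧ (∀ x, p x = 0 ↔ x = x₀) ∧ Differentiable ℂ q ∧
      (∀ x : X, (x : EuclideanSpace ℂ (Fin n)) ∈ U → q x = p x) ∧ (∀ z ∈ U, 0 < (q z).re) ∧
      (𝓝[≠] x₀).NeBot := by
  have : Nonempty (Fin n) := ⟨⟨0, hn⟩⟩
  obtain ⟨x₀, hx₀, hmax⟩ := hb.isCompact_closure.exists_isMaxOn hne.closure
    continuous_norm.continuousOn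
  have hle : ∀ z ∈ closure U, ‖z‖ ≤ ‖x₀‖ := fun z hz => hmax hz
  have hlt : ∀ z ∈ U, ‖z‖ < ‖x₀‖ := by
    have h1 : U ⊆ Metric.ball 0 ‖x₀‖ := by
      rw [← interior_closedBall']
      exact interior_maximal (fun z hz => by simpa using hle z (subset_closure hz)) hU
    exact fun z hz => by simpa using h1 hz
  set q : EuclideanSpace ℂ (Fin n) → ℂ := fun z => (‖x₀‖ ^ 2 : ℝ) - inner ℂ x₀ z with hq
  have hqd : Differentiable ℂ q := by
    have h1 : q = fun z => ((‖x₀‖ ^ 2 : ℝ) : ℂ) - innerSL ℂ x₀ z := rfl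
    rw [h1]
    fun_prop
  have hqre : ∀ z ∈ closure U, 0 ≤ (q z).re := fun z hz =>
    norm_sq_sub_inner_re_nonneg (hle z hz)
  -- `X` may be larger than `closure U`. Off the closure, the distance and the truncated real part
  -- keep `p` nonzero with `Re p ≥ 0`; on it, `p = q`.
  set d : EuclideanSpace ℂ (Fin n) → ℝ := fun z => Metric.infDist z (closure U) with hd
  have hd0 : ∀ z, 0 ≤ d z := fun z => Metric.infDist_nonneg
  have hdc : Continuous d := Metric.continuous_infDist_pt _
  have hd1 : ∀ z ∈ closure U, d z = 0 := fun z hz => Metric.infDist_zero_of_mem hz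
  have hre : ∀ z, ((max (q z).re 0 + d z : ℝ) + (q z).im * I : ℂ).re = max (q z).re 0 + d z :=
    fun z => by simp
  have hpq : ∀ z ∈ closure U, ((max (q z).re 0 + d z : ℝ) + (q z).im * I : ℂ) = q z := by
    intro z hz
    rw [hd1 z hz, max_eq_left (hqre z hz), add_zero, re_add_im]
  have hqx₀ : q x₀ = 0 := by
    simp only [hq]
    rw [inner_self_eq_norm_sq_to_K]
    simp
  refine ⟨⟨x₀, hUX hx₀⟩, ⟨fun x => ((max (q x).re 0 + d x : ℝ) + (q x).im * I : ℂ), ?_⟩, q,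
    ?_, ?_, hqd, ?_, ?_, ?_⟩
  · have := hqd.continuous
    fun_prop
  · intro x
    rw [ContinuousMap.coe_mk, hre]
    have := hd0 x
    positivity
  · intro x
    rw [ContinuousMap.coe_mk]
    refine ⟨fun h => ?_, fun h => ?_⟩
    · have h1 := congrArg re h
      rw [hre, zero_re] at h1
      have h2 : d x = 0 := by
        have := hd0 x
        have := le_max_right (q x).re 0
        linarith
      have hx : (x : EuclideanSpace ℂ (Fin n)) ∈ closure U := by
        rw [← isClosed_closure.closure_eq, Metric.mem_closure_iff_infDist_zero hne.closure]
        exact h2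
      rw [hpq x hx] at h
      have h3 : (inner ℂ x₀ (x : EuclideanSpace ℂ (Fin n)) : ℂ) = (‖x₀‖ ^ 2 : ℝ) :=
        (sub_eq_zero.1 h).symm
      refine Subtype.ext (eq_of_norm_le_re_inner_eq_norm_sq (𝕜 := ℂ) (hle x hx) ?_)
      rw [inner_re_symm, h3]
      exact ofReal_re _
    · rw [h, hpq x₀ hx₀, hqx₀]
  · intro x hx
    exact (hpq x (subset_closure hx)).symm
  · intro z hz
    have h1 : (inner ℂ x₀ z : ℂ).re ≤ ‖x₀‖ * ‖z‖ := re_inner_le_norm (𝕜 := ℂ) x₀ z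
    have h2 := hlt z hz
    simp only [hq]
    rw [sub_re, ofReal_re]
    nlinarith [norm_nonneg z]
  · rw [← mem_closure_iff_nhdsWithin_neBot, Metric.mem_closure_iff]
    intro ε hε
    obtain ⟨z, hz, hzε⟩ := Metric.mem_closure_iff.1 hx₀ ε hε
    refine ⟨⟨z, hUX (subset_closure hz)⟩, fun h => ?_, hzε⟩
    have h1 : z = x₀ := congrArg Subtype.val h
    exact (hlt z hz).ne (by rw [h1])

/-! ### Functions built from `p` -/

variable {n : ℕ} {X U : Set (EuclideanSpace ℂ (Fin n))}

/-- Composition of a half-plane algebra function with a function of nonnegative real part. -/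
theorem exists_comp_mem_holomorphicSubalgebra {p : C(X, ℂ)} {q : EuclideanSpace ℂ (Fin n) → ℂ}
    (hp : ∀ x, 0 ≤ (p x).re) (hq : Differentiable ℂ q)
    (hqp : ∀ x : X, (x : EuclideanSpace ℂ (Fin n)) ∈ U → q x = p x) (hqU : ∀ z ∈ U, 0 < (q z).re)
    {H : ℂ → ℂ} (hc : ContinuousOn H {z | 0 ≤ z.re}) (hd : DifferentiableOn ℂ H {z | 0 < z.re}) :
    ∃ f : holomorphicSubalgebra X U, ∀ x, f.1 x = H (p x) :=
  ⟨⟨⟨fun x => H (p x), hc.comp_continuous p.continuous hp⟩, fun z => H (q z),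
    hd.comp hq.differentiableOn hqU, fun x hx => by simp [hqp x hx]⟩, fun _ => rfl⟩

theorem mem_slitPlane_of_re_nonneg {w : ℂ} (hw : 0 ≤ w.re) (h0 : w ≠ 0) : w ∈ slitPlane := by
  rw [mem_slitPlane_iff]
  by_contra! h
  exact h0 (Complex.ext (le_antisymm h.1 hw) h.2)

/-- A product with an imaginary power of `p` is in the algebra when the other factor vanishes at
the zero of `p`. -/
theorem exists_cpow_mul_mem_holomorphicSubalgebra {p : C(X, ℂ)}
    {q : EuclideanSpace ℂ (Fin n) → ℂ} {x₀ : X}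
    (hp : ∀ x, 0 ≤ (p x).re) (hp0 : ∀ x, p x = 0 ↔ x = x₀) (hq : Differentiable ℂ q)
    (hqp : ∀ x : X, (x : EuclideanSpace ℂ (Fin n)) ∈ U → q x = p x) (hqU : ∀ z ∈ U, 0 < (q z).re)
    (t : ℝ) (a : holomorphicSubalgebra X U) (ha : a.1 x₀ = 0) :
    ∃ f : holomorphicSubalgebra X U, ∀ x, f.1 x = p x ^ (t * I : ℂ) * a.1 x := by
  have hcont : Continuous fun x => p x ^ (t * I : ℂ) * a.1 x := by
    rw [continuous_iff_continuousAt]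
    intro x
    by_cases hx : x = x₀
    · subst hx
      rw [ContinuousAt, ha, mul_zero]
      refine squeeze_zero_norm (a := fun y => Real.exp (|t| * Real.pi) * ‖a.1 y‖) (fun y => ?_) ?_
      · by_cases hy : y = x
        · rw [hy, ha]; simp
        · rw [norm_mul]
          gcongr
          exact norm_cpow_mul_I_le (fun h => hy ((hp0 y).1 h)) t
      · have h1 : Continuous fun y => Real.exp (|t| * Real.pi) * ‖a.1 y‖ := by fun_prop
        simpa [ha] using h1.tendsto x
    · have h1 : p x ∈ slitPlane :=
        mem_slitPlane_of_re_nonneg (hp x) fun h => hx ((hp0 x).1 h)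
      exact (p.continuous.continuousAt.cpow continuousAt_const h1).mul a.1.continuous.continuousAt
  obtain ⟨g, hg, hga⟩ := a.2
  refine ⟨⟨⟨_, hcont⟩, fun z => q z ^ (t * I : ℂ) * g z, ?_, fun x hx => ?_⟩, fun _ => rfl⟩
  · refine DifferentiableOn.mul (hq.differentiableOn.cpow_const fun z hz => Or.inl (hqU z hz)) hg
  · simp [hqp x hx, hga x hx]

/-- For every continuous `m` vanishing at the peak point some function of the algebra vanishes
there but is not `O(m)`. -/
theorem exists_not_le_mul_of_peak {p : C(X, ℂ)} {q : EuclideanSpace ℂ (Fin n) → ℂ} {x₀ : X}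
    [(𝓝[≠] x₀).NeBot]
    (hp : ∀ x, 0 ≤ (p x).re) (hp0 : ∀ x, p x = 0 ↔ x = x₀) (hq : Differentiable ℂ q)
    (hqp : ∀ x : X, (x : EuclideanSpace ℂ (Fin n)) ∈ U → q x = p x) (hqU : ∀ z ∈ U, 0 < (q z).re)
    {m : X → ℝ} (hm : ContinuousAt m x₀) (hm0 : m x₀ = 0) :
    ∃ a : holomorphicSubalgebra X U, a.1 x₀ = 0 ∧
      ¬ ∃ C, 0 ≤ C ∧ ∀ x, x ≠ x₀ → ‖a.1 x‖ ≤ C * m x := by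
  -- The rate `4⁻ᵏ` for `m` is beaten by the lower bound `2⁻ᵏ / 2` for `H ∘ p`.
  have hex : ∀ k : ℕ, ∃ x : X, x ≠ x₀ ∧ m x < (1 / 4 : ℝ) ^ k := by
    intro k
    have h1 : ∀ᶠ x in 𝓝 x₀, m x < (1 / 4 : ℝ) ^ k :=
      hm.eventually_lt_const (by rw [hm0]; positivity)
    obtain ⟨x, hx1, hx2⟩ :=
      ((h1.filter_mono nhdsWithin_le_nhds).and (self_mem_nhdsWithin (s := {x₀}ᶜ))).exists
    exact ⟨x, hx2, hx1⟩
  choose x hx hmx using hex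
  obtain ⟨H, hHc, hHd, hH0, hHk⟩ := exists_slowly_vanishing (w := fun k => p (x k))
    (fun k => hp _) (fun k h => hx k ((hp0 _).1 h))
  obtain ⟨a, ha⟩ := exists_comp_mem_holomorphicSubalgebra hp hq hqp hqU hHc hHd
  refine ⟨a, by rw [ha, (hp0 x₀).2 rfl, hH0], ?_⟩
  rintro ⟨C, hC, hle⟩
  have h2 : ∀ k : ℕ, (1 / 2 : ℝ) ≤ C * (1 / 2) ^ k := by
    intro k
    have h3 := (hHk k).trans ((ha (x k)).symm ▸ hle (x k) (hx k))
    have h4 : C * m (x k) ≤ C * ((1 / 2) ^ k * (1 / 2) ^ k) := by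
      rw [← mul_pow]
      norm_num only
      have := (hmx k).le
      gcongr
    have h5 : 0 < (1 / 2 : ℝ) ^ k := by positivity
    nlinarith
  have h6 : Tendsto (fun k : ℕ => C * (1 / 2 : ℝ) ^ k) atTop (𝓝 (C * 0)) :=
    (tendsto_pow_atTop_nhds_zero_of_lt_one (by norm_num) (by norm_num)).const_mul C
  have := ge_of_tendsto' h6 h2
  norm_num at this

/-! ### The intersection of two principal ideals -/

theorem not_isCoherentRing_holomorphicSubalgebra (hn : 1 ≤ n) (hX : IsCompact X) (hU : IsOpen U)
    (hne : U.Nonempty) (hUX : U ⊆ X) : ¬ IsCoherentRing (holomorphicSubalgebra X U) := by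
  intro hcoh
  have : CompactSpace X := isCompact_iff_compactSpace.1 hX
  obtain ⟨x₀, p, q, hp, hp0, hq, hqp, hqU, hbot⟩ := exists_peak hn hU hne
    (hX.isBounded.subset hUX) (closure_minimal hUX hX.isClosed)
  obtain ⟨z, hz⟩ := exists_seq_tendsto (𝓝[≠] x₀)
  obtain ⟨hz, hzne⟩ := tendsto_nhdsWithin_iff.1 hz
  obtain ⟨N, hN⟩ := eventually_atTop.1 hzne
  have hpx₀ : p x₀ = 0 := (hp0 x₀).2 rfl
  have hpne : ∀ x, x ≠ x₀ → p x ≠ 0 := fun x hx h => hx ((hp0 x).1 h)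
  have hz' : Tendsto (fun k => z (k + N)) atTop (𝓝 x₀) := hz.comp (tendsto_add_atTop_nat N)
  have hzN : ∀ k, z (k + N) ≠ x₀ := fun k => hN _ (Nat.le_add_left _ _)
  obtain ⟨t, ht⟩ := exists_not_tendsto_cpow (w := fun k => p (z (k + N)))
    (fun k => hpne _ (hzN k)) (hpx₀ ▸ (p.continuous.tendsto x₀).comp hz')
  obtain ⟨f, hf⟩ := exists_comp_mem_holomorphicSubalgebra hp hq hqp hqU continuousOn_id
    differentiableOn_id
  simp only [id] at hf
  obtain ⟨g, hg⟩ := exists_cpow_mul_mem_holomorphicSubalgebra hp hp0 hq hqp hqU t f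
    (by rw [hf, hpx₀])
  have hcpow : ∀ x, x ≠ x₀ → p x ^ (t * I : ℂ) ≠ 0 := fun x hx h =>
    hpne x hx (((cpow_eq_zero_iff _ _).1 h).1)
  have hgne : ∀ x, x ≠ x₀ → g.1 x ≠ 0 := fun x hx => by
    rw [hg, hf]
    exact mul_ne_zero (hcpow x hx) (hpne x hx)
  obtain ⟨S, hS⟩ := hcoh (Ideal.span {f}) (Ideal.span {g})
    (Submodule.fg_span_singleton _) (Submodule.fg_span_singleton _)
  have hfac : ∀ s ∈ Ideal.span {f} ⊓ Ideal.span {g},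
      ∃ a : holomorphicSubalgebra X U, s = g * a ∧ a.1 x₀ = 0 := by
    rintro s ⟨hs1, hs2⟩
    obtain ⟨b, hb⟩ := Ideal.mem_span_singleton'.1 hs1
    obtain ⟨a, ha⟩ := Ideal.mem_span_singleton'.1 hs2
    refine ⟨a, by rw [← ha, mul_comm], ?_⟩
    by_contra ha0
    refine ht ⟨b.1 x₀ / a.1 x₀, ?_⟩
    have h1 : Tendsto (fun k => b.1 (z (k + N)) / a.1 (z (k + N))) atTop
        (𝓝 (b.1 x₀ / a.1 x₀)) :=
      ((b.1.continuous.tendsto x₀).comp hz').div ((a.1.continuous.tendsto x₀).comp hz') ha0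
    have h2 : ∀ᶠ k in atTop, a.1 (z (k + N)) ≠ 0 :=
      ((a.1.continuous.tendsto x₀).comp hz').eventually_ne ha0
    refine h1.congr' ?_
    filter_upwards [h2] with k hk
    have h3 : b.1 (z (k + N)) * f.1 (z (k + N)) = a.1 (z (k + N)) * g.1 (z (k + N)) :=
      congrArg (fun s : holomorphicSubalgebra X U => s.1 (z (k + N))) (hb.trans ha.symm)
    rw [hg, hf] at h3
    rw [div_eq_iff hk]
    refine mul_right_cancel₀ (hpne _ (hzN k)) ?_
    rw [h3]; ring
  have hmem : ∀ s ∈ S, s ∈ Ideal.span {f} ⊓ Ideal.span {g} := fun s hs =>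
    hS ▸ Submodule.subset_span hs
  have hfac' : ∀ s : holomorphicSubalgebra X U, ∃ a : holomorphicSubalgebra X U,
      s ∈ S → s = g * a ∧ a.1 x₀ = 0 := by
    intro s
    by_cases hs : s ∈ S
    · obtain ⟨a, ha⟩ := hfac s (hmem s hs)
      exact ⟨a, fun _ => ha⟩
    · exact ⟨0, fun h => absurd h hs⟩
  choose m hm using hfac'
  obtain ⟨a, ha0, hbig⟩ := exists_not_le_mul_of_peak hp hp0 hq hqp hqU
    (m := fun x => ∑ s ∈ S, ‖(m s).1 x‖)
    (by
      have : Continuous fun x => ∑ s ∈ S, ‖(m s).1 x‖ := by fun_prop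
      exact this.continuousAt)
    (Finset.sum_eq_zero fun s hs => by rw [(hm s hs).2, norm_zero])
  obtain ⟨b, hb⟩ := exists_cpow_mul_mem_holomorphicSubalgebra hp hp0 hq hqp hqU t a ha0
  have hga : g * a ∈ Ideal.span (S : Set (holomorphicSubalgebra X U)) := by
    rw [hS]
    refine ⟨Ideal.mem_span_singleton'.2 ⟨b, ?_⟩, Ideal.mem_span_singleton'.2 ⟨a, mul_comm _ _⟩⟩
    refine Subtype.ext (ContinuousMap.ext fun x => ?_)
    change b.1 x * f.1 x = g.1 x * a.1 x
    rw [hb, hg]; ring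
  obtain ⟨c, -, hc⟩ := Submodule.mem_span_finset.1 hga
  -- The coefficients `c s` are bounded because `X` is compact; their sup norms add up to the
  -- constant.
  refine hbig ⟨∑ s ∈ S, ‖(c s).1‖, by positivity, fun x hx => ?_⟩
  have hax : a.1 x = ∑ s ∈ S, (c s).1 x * (m s).1 x := by
    refine mul_left_cancel₀ (hgne x hx) ?_
    have h1 : (∑ s ∈ S, c s • s) = g * ∑ s ∈ S, c s * m s := by
      rw [Finset.mul_sum]
      refine Finset.sum_congr rfl fun s hs => ?_
      rw [smul_eq_mul, mul_left_comm, ← (hm s hs).1]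
    have h2 := congrArg (fun s : holomorphicSubalgebra X U => s.1 x) (h1.symm.trans hc)
    simpa using h2.symm
  rw [hax, Finset.sum_mul]
  refine (norm_sum_le _ _).trans (Finset.sum_le_sum fun s hs => ?_)
  rw [norm_mul]
  refine mul_le_mul ((c s).1.norm_coe_le_norm x) ?_ (norm_nonneg _) (norm_nonneg _)
  exact Finset.single_le_sum (f := fun s => ‖(m s).1 x‖) (fun _ _ => norm_nonneg _) hs

theorem mainTheorem1 (n : ℕ) (hn : 1 ≤ n) :
    (∀ Ω : Set (EuclideanSpace ℂ (Fin n)), IsOpen Ω → IsConnected Ω → Bornology.IsBounded Ω →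
      ¬ IsCoherentRing (domainAlgebra Ω)) ∧
    (∀ K : Set (EuclideanSpace ℂ (Fin n)), IsCompact K → (interior K).Nonempty →
      ¬ IsCoherentRing (compactAlgebra K)) :=
  ⟨fun _ hΩ hc hb => not_isCoherentRing_holomorphicSubalgebra hn hb.isCompact_closure hΩ
    hc.nonempty subset_closure,
  fun _ hK hne => not_isCoherentRing_holomorphicSubalgebra hn hK isOpen_interior hne
    interior_subset⟩
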